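/- Let $d\in\mathbb N$ and let $j=(j^0,J):\mathbb R\times\mathbb R^d\to\mathbb R\times\mathbb R^d$ be a current vector field, that is: $j$ is a $C^1$ vector field; $\operatorname{div} j=\partial_t j^0+\sum_{i=1}^d\partial_{q_i}J_i=0$ on $\mathbb R\times\mathbb R^d$; $j^0(t,q)>0$ whenever $j(t,q)\neq 0$; and $\int_{\mathbb R^d}j^0(t,q)\,dq=1$ for every $t\in\mathbb R$. Suppose that there is a constant $c>0$ such that $|J(t,q)|\le c\,j^0(t,q)$ for all $(t,q)\in\mathbb R\times\mathbb R^d$, where $|\cdot|$ is the Euclidean norm. For $t\in\mathbb R$ let $\mu_t$ be the measure on $\mathbb R^d$ with $\mu_t(dq)=j^0(t,q)\,dq$. Consider the differential equation $$\frac{dQ}{dt}(t)=\frac{J(t,Q(t))}{j^0(t,Q(t))},\qquad\qquad (*)$$ whose right-hand side is defined where $j(t,Q(t))\ne0$. For $q$ with $j(0,q)\neq0$ let $Q_q$ be the maximal solution of $(*)$ with $Q_q(0)=q$, defined on an open interval $(\tau_q^-,\tau_q^+)\ni 0$ (every solution on an open interval containing $0$ with value $q$ at time $0$ is a restriction of it).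 Define the flow map $\varphi_t:\mathbb R^d\to\mathbb R^d\cup\{\dagger\}$, where $\dagger$ is an added cemetery point, by $\varphi_t(q)=Q_q(t)$ if $j(0,q)\ne0$ and $\tau_q^-<t<\tau_q^+$, by $\varphi_0(q)=q$ if $j(0,q)=0$, and by $\varphi_t(q)=\dagger$ in all other cases. Then: 1. for $\mu_0$-almost every $q\in\mathbb R^d$ the maximal solution $Q_q$ of $(*)$ with $Q_q(0)=q$ exists for all times, i.e. $(\tau_q^-,\tau_q^+)=\mathbb R$; 2. the family $(\mu_t)_{t\in\mathbb R}$ is equivariant on $\mathbb R$: for every $t\in\mathbb R$ the distribution $\rho_t=\mu_0\circ\varphi_t^{-1}$ of $\varphi_t(q)$, when $q$ has distribution $\mu_0$, equals $\mu_t$ (regarded as a measure on $\mathbb R^d\cup\{\dagger\}$ giving mass $0$ to $\dagger$). -/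

import Mathlib

open MeasureTheory Set

noncomputable section

namespace CurrentFlow

/-- The configuration space `ℝ^d`, with the Euclidean norm and Lebesgue measure. -/
abbrev Conf (d : ℕ) : Type := EuclideanSpace ℝ (Fin d)

/-- Space-time divergence `∂_t j⁰ + ∑ᵢ ∂ᵢ Jᵢ` of a vector field `j = (j⁰, J)` on `ℝ × ℝ^d`. -/
def divergence {d : ℕ} (j : ℝ × Conf d → ℝ × Conf d) (p : ℝ × Conf d) : ℝ :=
  (fderiv ℝ j p (1, 0)).1 + ∑ i : Fin d, (fderiv ℝ j p (0, EuclideanSpace.single i 1)).2 i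

/-- Current vector fields on `ℝ × ℝ^d`. (The value `1` of the Bochner integral forces the function
`q ↦ j⁰ (t, q)` to be integrable.) -/
structure IsCurrent {d : ℕ} (j : ℝ × Conf d → ℝ × Conf d) : Prop where
  contDiff : ContDiff ℝ 1 j
  divergence_eq_zero : ∀ p, divergence j p = 0
  pos_of_ne_zero : ∀ p, j p ≠ 0 → 0 < (j p).1
  integral_eq_one : ∀ t : ℝ, ∫ q : Conf d, (j (t, q)).1 = 1

/-- The velocity field `J / j⁰`; it is only used away from the nodes (zeros) of `j`. -/
def velocity {d : ℕ} (j : ℝ × Conf d → ℝ × Conf d) (p : ℝ × Conf d) : Conf d :=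
  (j p).1⁻¹ • (j p).2

/-- `Q`, restricted to the open interval `I ∋ 0`, is a solution of `dQ/dt = J(t,Q)/j⁰(t,Q)` with
`Q(0) = q`. The right-hand side has to be defined along a solution, so the solution stays away from
the nodes of `j`. -/
structure IsSolutionOn {d : ℕ} (j : ℝ × Conf d → ℝ × Conf d) (q : Conf d) (I : Set ℝ)
    (Q : ℝ → Conf d) : Prop where
  isOpen : IsOpen I
  ordConnected : I.OrdConnected
  zero_mem : (0 : ℝ) ∈ I
  initial : Q 0 = q
  not_node : ∀ t ∈ I, j (t, Q t) ≠ 0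
  hasDerivAt : ∀ t ∈ I, HasDerivAt Q (velocity j (t, Q t)) t

/-- `Q` on `I` is the maximal solution starting at `q`: every solution starting at `q` is a
restriction of it. By definition `I` and the restriction of `Q` to `I` are determined by `q`. -/
structure IsMaximalSolution {d : ℕ} (j : ℝ × Conf d → ℝ × Conf d) (q : Conf d) (I : Set ℝ)
    (Q : ℝ → Conf d) : Prop where
  isSolutionOn : IsSolutionOn j q I Q
  maximal : ∀ (I' : Set ℝ) (Q' : ℝ → Conf d), IsSolutionOn j q I' Q' → I' ⊆ I ∧ EqOn Q' Q I'

open Classical in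
/-- The flow map `φ_t : ℝ^d → ℝ^d ∪ {†}`, where the cemetery `†` is `Sum.inr ()`: the value at `t`
of the maximal solution starting at `q` if `t` lies in its interval of existence, and `†`
otherwise; if `(0, q)` is a node, then `φ_0(q) = q` and `φ_t(q) = †` for `t ≠ 0`. -/
def flow {d : ℕ} (j : ℝ × Conf d → ℝ × Conf d) (t : ℝ) (q : Conf d) : Conf d ⊕ Unit :=
  if h : ∃ x : Conf d, ∃ (I : Set ℝ) (Q : ℝ → Conf d),
      IsMaximalSolution j q I Q ∧ t ∈ I ∧ Q t = x then Sum.inl h.choose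
  else if t = 0 then Sum.inl q
  else Sum.inr ()

/-- The measure `μ_t(dq) = j⁰(t, q) dq` on `ℝ^d`. -/
def currentMeasure {d : ℕ} (j : ℝ × Conf d → ℝ × Conf d) (t : ℝ) : Measure (Conf d) :=
  (volume : Measure (Conf d)).withDensity fun q => ENNReal.ofReal (j (t, q)).1

/-- The distribution `ρ_t = μ_0 ∘ φ_t⁻¹` on `ℝ^d ∪ {†}`. (`Measure.map` is zero for a map that is
not almost everywhere measurable, so an equality of `ρ_t` with a nonzero measure includes the
measurability of `φ_t`.) -/
def flowMeasure {d : ℕ} (j : ℝ × Conf d → ℝ × Conf d) (t : ℝ) : Measure (Conf d ⊕ Unit) :=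
  (currentMeasure j 0).map (flow j t)

/-- Equivariance on the time set `S`: `ρ_t = μ_t` for all `t ∈ S`, where `μ_t` is regarded as a
measure on `ℝ^d ∪ {†}`. -/
def IsEquivariantOn {d : ℕ} (j : ℝ × Conf d → ℝ × Conf d) (S : Set ℝ) : Prop :=
  ∀ t ∈ S, flowMeasure j t = (currentMeasure j t).map Sum.inl

end CurrentFlow

end

/-! The bound `|J| ≤ c j⁰` makes the velocity `v = J / j⁰` bounded by `c`, so no trajectory escapes
to infinity in finite time. A solution can stop only by running into a node. The proof shows that
this happens with probability zero, and that mass is transported correctly in the meantime.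

Cutting `v` off outside a compact set where `j⁰` is bounded below gives a bounded Lipschitz field
with a global flow `X n`. It follows the true dynamics for the survivors, the points whose
trajectory remains in `coreSet j n`. For a test function `g` supported among survivors, `∫ g(X s 0
q) j⁰(s, q) dq` does not depend on `s`: the transport equation for `g ∘ X s 0`, the continuity
equation `div j = 0` and an integration by parts cancel (`integral_transport_eq`). Hence the flow
carries the surviving part of `μ_0` to a measure below `μ_t`
(`IsTruncatedFlow.map_restrict_survivors_le`).

This domination also controls nodes. The weight `1 / j⁰` cancels the density of `μ_t`, so the
`μ_0`-integral of `1 / j⁰` along surviving trajectories from a ball is at most the volume of a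
larger ball, uniformly in `n`. But along a trajectory `|d(log j⁰)/du| ≤ M / j⁰`, so a drop of the
density from `ε` to `1 / (n + 1)` costs at least `log(ε (n + 1)) / M` in the time integral of `1 /
j⁰`. A set of positive measure on which this happens for every `n` would contradict the uniform
bound (`measure_diff_iUnion_survivors`).

So almost every solution is global, and the domination passes to the limit: `μ_0 ∘ φ_t⁻¹ ≤ μ_t`.
Both are probability measures, hence equal. -/

namespace CurrentFlow

open Filter Topology Metric
open scoped NNReal ENNReal

/-! ### Global flows of bounded, uniformly Lipschitz time-dependent fields. -/

section GlobalFlow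

variable {E : Type*} [NormedAddCommGroup E] [NormedSpace ℝ E]

/-- Grönwall's inequality for two integral curves of a Lipschitz field, in both time directions. -/
theorem dist_le_of_isIntegralCurve {V : ℝ → E → E} {K : ℝ≥0} (hK : ∀ t, LipschitzWith K (V t))
    {γ₁ γ₂ : ℝ → E} (h₁ : IsIntegralCurve γ₁ V) (h₂ : IsIntegralCurve γ₂ V) (s t : ℝ) :
    dist (γ₁ t) (γ₂ t) ≤ dist (γ₁ s) (γ₂ s) * Real.exp (K * |t - s|) := by
  rcases le_total s t with h | h
  · have := dist_le_of_trajectories_ODE (a := s) (b := t) hK h₁.continuous.continuousOn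
      (fun r _ => (h₁ r).hasDerivWithinAt) h₂.continuous.continuousOn
      (fun r _ => (h₂ r).hasDerivWithinAt) le_rfl t ⟨h, le_rfl⟩
    rwa [abs_of_nonneg (sub_nonneg.2 h)]
  -- Backward times are reduced to forward ones by the reversal `r ↦ -r`, which turns the field into
  -- `-V (-r)`.
  · have hneg : ∀ {γ : ℝ → E}, IsIntegralCurve γ V → ∀ r,
        HasDerivAt (fun r => γ (-r)) (-V (-r) (γ (-r))) r := by
      intro γ hγ r
      simpa using! (hγ (-r)).scomp r (hasDerivAt_neg r)
    have := dist_le_of_trajectories_ODE (a := -s) (b := -t) (v := fun r x => -V (-r) x)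
      (f := fun r => γ₁ (-r)) (g := fun r => γ₂ (-r)) (K := K)
      (fun r => (hK (-r)).neg) (h₁.continuous.comp continuous_neg).continuousOn
      (fun r _ => (hneg h₁ r).hasDerivWithinAt)
      (h₂.continuous.comp continuous_neg).continuousOn
      (fun r _ => (hneg h₂ r).hasDerivWithinAt) le_rfl (-t) ⟨by linarith, le_rfl⟩
    simp only [neg_neg] at this
    rw [abs_of_nonpos (sub_nonpos.2 h)]
    convert! this using 4
    ring

theorem dist_le_of_bounded {V : ℝ → E → E} {c : ℝ} (hc : ∀ t x, ‖V t x‖ ≤ c)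
    {γ : ℝ → E} (h : IsIntegralCurve γ V) (s t : ℝ) : dist (γ s) (γ t) ≤ c * |s - t| := by
  rw [dist_eq_norm, ← Real.norm_eq_abs]
  exact convex_univ.norm_image_sub_le_of_norm_hasDerivWithin_le
    (fun x _ => (h x).hasDerivWithinAt) (fun x _ => hc x _) (mem_univ _) (mem_univ _)

/-- Since `V` is bounded by `c` everywhere, Picard–Lindelöf on a ball of radius `c * T` works on the
whole interval of half-length `T`, for every `T`. Uniqueness glues these curves. -/
theorem exists_isIntegralCurve [CompleteSpace E] {V : ℝ → E → E} {K : ℝ≥0} {c : ℝ}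
    (hV : Continuous (Function.uncurry V)) (hK : ∀ t, LipschitzWith K (V t))
    (hc : ∀ t x, ‖V t x‖ ≤ c) (t₀ : ℝ) (x₀ : E) :
    ∃ γ : ℝ → E, γ t₀ = x₀ ∧ IsIntegralCurve γ V := by
  have hc0 : 0 ≤ c := (norm_nonneg _).trans (hc t₀ x₀)
  have loc : ∀ T : ℝ, 0 < T → ∃ γ : ℝ → E, γ t₀ = x₀ ∧
      ∀ t ∈ Ioo (t₀ - T) (t₀ + T), HasDerivAt γ (V t (γ t)) t := by
    intro T hT
    have hp : IsPicardLindelof V (tmin := t₀ - T) (tmax := t₀ + T)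
        ⟨t₀, by constructor <;> linarith⟩ x₀ (⟨c, hc0⟩ * ⟨T, hT.le⟩) 0 ⟨c, hc0⟩ K :=
      { lipschitzOnWith := fun t _ => (hK t).lipschitzOnWith
        continuousOn := fun x _ => (hV.comp (Continuous.prodMk_left x)).continuousOn
        norm_le := fun t _ x _ => hc t x
        mul_max_le := by
          simp only [NNReal.coe_zero, sub_zero, add_sub_cancel_left, sub_sub_cancel, max_self]
          exact le_rfl }
    obtain ⟨γ, h0, hγ⟩ := hp.exists_eq_forall_mem_Icc_hasDerivWithinAt₀
    exact ⟨γ, h0, fun t ht => (hγ t (Ioo_subset_Icc_self ht)).hasDerivAt (Icc_mem_nhds ht.1 ht.2)⟩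
  choose! γ h0 hγ using loc
  have uniq : ∀ S T : ℝ, 0 < S → S ≤ T → EqOn (γ S) (γ T) (Ioo (t₀ - S) (t₀ + S)) := by
    intro S T hS hST
    refine ODE_solution_unique_of_mem_Ioo (v := V) (s := fun _ => univ) (K := K) (t₀ := t₀)
      (fun t _ => (hK t).lipschitzOnWith) ⟨by linarith, by linarith⟩
      (fun t ht => ⟨hγ S hS t ht, mem_univ _⟩)
      (fun t ht => ⟨hγ T (hS.trans_le hST) t ⟨by linarith [ht.1], by linarith [ht.2]⟩,
        mem_univ _⟩) ?_
    rw [h0 S hS, h0 T (hS.trans_le hST)]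
  -- At each time the curve is read off from an interval that contains this time in its interior;
  -- near `t` all choices agree with the single curve for `|t - t₀| + 2`.
  refine ⟨fun t => γ (|t - t₀| + 1) t, h0 _ (by positivity), fun t => ?_⟩
  have hmem : ∀ r : ℝ, r ∈ Ioo (t₀ - (|r - t₀| + 1)) (t₀ + (|r - t₀| + 1)) := fun r =>
    ⟨by linarith [neg_abs_le (r - t₀)], by linarith [le_abs_self (r - t₀)]⟩
  have hev : (fun r => γ (|r - t₀| + 1) r) =ᶠ[𝓝 t] γ (|t - t₀| + 2) := by
    have : ∀ᶠ r in 𝓝 t, |r - t₀| < |t - t₀| + 1 :=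
      (continuous_abs.comp (continuous_id.sub continuous_const)).continuousAt.eventually_lt
        continuousAt_const (by simp)
    filter_upwards [this] with r hr
    exact uniq _ _ (by positivity) (by linarith) (hmem r)
  have := hγ (|t - t₀| + 2) (by positivity) t
    ⟨by linarith [(hmem t).1], by linarith [(hmem t).2]⟩
  rw [← hev.self_of_nhds] at this
  exact this.congr_of_eventuallyEq hev

/-- `X s t x` is the value at time `t` of an integral curve of `V` through `x` at time `s`. -/
structure IsGlobalFlow (V : ℝ → E → E) (X : ℝ → ℝ → E → E) : Prop where
  self : ∀ s x, X s s x = x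
  isIntegralCurve : ∀ s x, IsIntegralCurve (fun t => X s t x) V

theorem exists_isGlobalFlow [CompleteSpace E] {V : ℝ → E → E} {K : ℝ≥0} {c : ℝ}
    (hV : Continuous (Function.uncurry V)) (hK : ∀ t, LipschitzWith K (V t))
    (hc : ∀ t x, ‖V t x‖ ≤ c) : ∃ X, IsGlobalFlow V X := by
  choose X h0 hX using exists_isIntegralCurve hV hK hc
  exact ⟨fun s t x => X s x t, h0, hX⟩

namespace IsGlobalFlow

variable {V : ℝ → E → E} {X : ℝ → ℝ → E → E} {K : ℝ≥0} {c : ℝ}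

theorem eq_of_isIntegralCurve (hX : IsGlobalFlow V X) (hK : ∀ t, LipschitzWith K (V t))
    {γ : ℝ → E} (hγ : IsIntegralCurve γ V) (s t : ℝ) : X s t (γ s) = γ t := by
  have := dist_le_of_isIntegralCurve hK (hX.isIntegralCurve s (γ s)) hγ s t
  rw [hX.self, dist_self, zero_mul] at this
  exact dist_le_zero.1 this

theorem comp (hX : IsGlobalFlow V X) (hK : ∀ t, LipschitzWith K (V t)) (r s t : ℝ) (x : E) :
    X s t (X r s x) = X r t x :=
  hX.eq_of_isIntegralCurve hK (hX.isIntegralCurve r x) s t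

theorem comp_self (hX : IsGlobalFlow V X) (hK : ∀ t, LipschitzWith K (V t)) (s t : ℝ) (x : E) :
    X t s (X s t x) = x := by
  rw [hX.comp hK, hX.self]

theorem dist_le (hX : IsGlobalFlow V X) (hK : ∀ t, LipschitzWith K (V t)) (s t : ℝ) (x y : E) :
    dist (X s t x) (X s t y) ≤ Real.exp (K * |t - s|) * dist x y := by
  have := dist_le_of_isIntegralCurve hK (hX.isIntegralCurve s x) (hX.isIntegralCurve s y) s t
  rwa [hX.self, hX.self, mul_comm] at this

theorem dist_time_le (hX : IsGlobalFlow V X) (hc : ∀ t x, ‖V t x‖ ≤ c) (r s t : ℝ) (x : E) :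
    dist (X r s x) (X r t x) ≤ c * |s - t| :=
  dist_le_of_bounded hc (hX.isIntegralCurve r x) s t

theorem dist_initial_time_le (hX : IsGlobalFlow V X) (hK : ∀ t, LipschitzWith K (V t))
    (hc : ∀ t x, ‖V t x‖ ≤ c) (s s' t : ℝ) (x : E) :
    dist (X s t x) (X s' t x) ≤ Real.exp (K * |t - s|) * (c * |s' - s|) := by
  rw [← hX.comp hK s' s t x]
  refine (hX.dist_le hK s t _ _).trans ?_
  gcongr
  simpa only [hX.self] using hX.dist_time_le hc s' s' s x

theorem continuous_uncurry (hX : IsGlobalFlow V X) (hK : ∀ t, LipschitzWith K (V t)) (s : ℝ) :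
    Continuous fun p : ℝ × E => X s p.1 p.2 := by
  rw [continuous_iff_continuousAt]
  rintro ⟨t, x⟩
  rw [ContinuousAt, tendsto_iff_dist_tendsto_zero]
  have h1 : Tendsto (fun p : ℝ × E => Real.exp (K * |p.1 - s|) * dist p.2 x +
      dist (X s p.1 x) (X s t x)) (𝓝 (t, x)) (𝓝 0) := by
    have hcont := (hX.isIntegralCurve s x).continuous
    have : Continuous fun p : ℝ × E => Real.exp (K * |p.1 - s|) * dist p.2 x +
      dist (X s p.1 x) (X s t x) := by fun_prop
    simpa using this.tendsto (t, x)
  refine squeeze_zero (fun _ => dist_nonneg) (fun p => ?_) h1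
  exact (dist_triangle _ (X s p.1 x) _).trans (by gcongr; exact hX.dist_le hK _ _ _ _)

theorem continuous (hX : IsGlobalFlow V X) (hK : ∀ t, LipschitzWith K (V t)) (s t : ℝ) :
    Continuous (X s t) :=
  (hX.continuous_uncurry hK s).comp (Continuous.prodMk_right t)

/-- Between `s'` and `s` the curve from `x` stays near `x`, so its displacement is `(s - s') • V s
x` up to `o(s - s')`. Only continuity and boundedness of `V` enter; no spatial derivative of the
flow is needed. -/
theorem hasDerivAt_initial_time (hX : IsGlobalFlow V X) (hV : Continuous (Function.uncurry V))
    (hc : ∀ t x, ‖V t x‖ ≤ c) (s : ℝ) (x : E) :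
    HasDerivAt (fun s' => X s' s x) (-V s x) s := by
  have hc0 : 0 ≤ c := (norm_nonneg _).trans (hc s x)
  rw [hasDerivAt_iff_isLittleO, Asymptotics.isLittleO_iff]
  intro ε hε
  obtain ⟨δ, hδ, hball⟩ := Metric.continuousAt_iff.1 (hV.continuousAt (x := (s, x))) ε hε
  -- With this radius both the time lag `|s' - s|` and the displacement bound `c * |s' - s|` are
  -- below `δ`.
  have hδ' : 0 < δ / (c + 1) := by positivity
  filter_upwards [Metric.ball_mem_nhds s hδ'] with s' hs'
  rw [Metric.mem_ball, Real.dist_eq] at hs'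
  have hs'δ : (c + 1) * |s' - s| < δ := by rwa [mul_comm, ← lt_div_iff₀ (by positivity)]
  have hs'c : c * |s' - s| < δ := by linarith [abs_nonneg (s' - s)]
  have hs'1 : |s' - s| < δ := by
    linarith [mul_nonneg hc0 (abs_nonneg (s' - s))]
  have key := (convex_uIcc s s').norm_image_sub_le_of_norm_hasDerivWithin_le
    (f := fun r => X s' r x - r • V s x) (f' := fun r => V r (X s' r x) - V s x) (C := ε)
    (x := s') (y := s)
    (fun r _ => (((hX.isIntegralCurve s' x) r).sub
      (by simpa using (hasDerivAt_id r).smul_const (V s x))).hasDerivWithinAt)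
    (fun r hr => by
      have hrs := abs_sub_left_of_mem_uIcc hr
      have hrs' := abs_sub_right_of_mem_uIcc hr
      rw [← dist_eq_norm]
      refine (hball (x := (r, X s' r x)) ?_).le
      rw [Prod.dist_eq, max_lt_iff]
      constructor
      · rw [Real.dist_eq]; exact hrs.trans_lt hs'1
      · have := hX.dist_time_le hc s' r s' x
        rw [hX.self] at this
        refine this.trans_lt (lt_of_le_of_lt ?_ hs'c)
        rw [abs_sub_comm r]
        gcongr)
    right_mem_uIcc left_mem_uIcc
  simp only [hX.self] at key ⊢
  rw [norm_sub_rev s' s]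
  convert! key using 2
  module

end IsGlobalFlow

end GlobalFlow

/-! ### Cutoff functions. -/

section Bump

variable {E : Type*} [NormedAddCommGroup E] [NormedSpace ℝ E] [FiniteDimensional ℝ E]

theorem exists_contDiff_bump {K U : Set E} (hK : IsCompact K) (hU : IsOpen U) (hKU : K ⊆ U) :
    ∃ f : E → ℝ, ContDiff ℝ 1 f ∧ HasCompactSupport f ∧ tsupport f ⊆ U ∧
      (∀ x ∈ K, f =ᶠ[𝓝 x] 1) ∧ ∀ x, f x ∈ Icc (0 : ℝ) 1 := by
  obtain ⟨L, hL, hKL, hLU⟩ := exists_compact_between hK hU hKU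
  obtain ⟨f, h1, h0, h01⟩ := exists_contMDiffMap_one_nhds_of_subset_interior
    (modelWithCornersSelf ℝ E) (n := 1) hK.isClosed hKL
  have hsupp : Function.support f ⊆ L := fun x hx => by_contra fun h => hx (h0 x h)
  refine ⟨f, f.contMDiff.contDiff, HasCompactSupport.of_support_subset_isCompact hL hsupp,
    (closure_minimal hsupp hL.isClosed).trans hLU, fun x hx => ?_, h01⟩
  exact h1.filter_mono (nhds_le_nhdsSet hx)

end Bump

/-! ### Integration by parts for Lipschitz functions. -/

/-- Integration by parts of a compactly supported Lipschitz function against a `C¹` field. -/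
theorem integral_fderiv_apply_add_mul_div {d : ℕ} {f : Conf d → ℝ} {C : ℝ≥0}
    (hf : LipschitzWith C f) (hfs : HasCompactSupport f) {W : Conf d → Conf d}
    (hW : ContDiff ℝ 1 W) :
    ∫ x, (fderiv ℝ f x (W x) +
      f x * ∑ i, fderiv ℝ W x (EuclideanSpace.single i 1) i) = 0 := by
  -- The cutoff `χ` is `1` near the support of `f`, so replacing `W` by `χ • W` changes neither term
  -- of the integrand, and its components become compactly supported and Lipschitz.
  obtain ⟨χ, hχ, hχs, -, hχ1, -⟩ := exists_contDiff_bump hfs isOpen_univ (subset_univ _)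
  set e : Fin d → Conf d := fun i => EuclideanSpace.single i 1
  have hWi : ∀ i, ContDiff ℝ 1 fun x => W x i := fun i => contDiff_euclidean.1 hW i
  set w : Fin d → Conf d → ℝ := fun i x => χ x * W x i with hw
  have hwC : ∀ i, ContDiff ℝ 1 (w i) := fun i => hχ.mul (hWi i)
  have hws : ∀ i, HasCompactSupport (w i) := fun i => hχs.mul_right
  have hwL : ∀ i, ∃ D, LipschitzWith D (w i) := fun i =>
    (hwC i).lipschitzWith_of_hasCompactSupport (hws i) one_ne_zero
  have hwfd : ∀ i x, f x * fderiv ℝ W x (e i) i = f x * fderiv ℝ (w i) x (e i) := by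
    intro i x
    by_cases hx : f x = 0
    · simp [hx]
    · have h1 : w i =ᶠ[𝓝 x] fun y => W y i := by
        filter_upwards [hχ1 x (subset_tsupport f hx)] with y hy
        simp [hw, hy]
      have h2 : HasFDerivAt (fun y => W y i)
          ((EuclideanSpace.proj i : Conf d →L[ℝ] ℝ).comp (fderiv ℝ W x)) x :=
        (EuclideanSpace.proj i : Conf d →L[ℝ] ℝ).hasFDerivAt.comp x
          (hW.differentiable one_ne_zero x).hasFDerivAt
      rw [h1.fderiv_eq, h2.fderiv]
      rfl
  have hI1 : ∀ i, Integrable fun x => lineDeriv ℝ f x (e i) * w i x := fun i =>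
    ((hwC i).continuous.integrable_of_hasCompactSupport (hws i)).bdd_mul
      (c := C * ‖e i‖) (aestronglyMeasurable_lineDeriv hf.continuous _)
      (.of_forall fun x => norm_lineDeriv_le_of_lipschitz ℝ hf)
  have hI2 : ∀ i, Integrable fun x => f x * fderiv ℝ W x (e i) i := fun i =>
    Continuous.integrable_of_hasCompactSupport
      (hf.continuous.mul ((EuclideanSpace.proj i : Conf d →L[ℝ] ℝ).continuous.comp
        ((hW.continuous_fderiv one_ne_zero).clm_apply continuous_const))) hfs.mul_right
  have hibp : ∀ i, ∫ x, (lineDeriv ℝ f x (e i) * w i x + f x * fderiv ℝ W x (e i) i) = 0 := by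
    intro i
    obtain ⟨D, hD⟩ := hwL i
    rw [integral_add (hI1 i) (hI2 i), hf.integral_lineDeriv_mul_eq hD (hws i) (e i), ← integral_add ?_ (hI2 i)]
    · refine integral_eq_zero_of_ae (.of_forall fun x => ?_)
      have hdx := (hwC i).differentiable one_ne_zero x
      simp only [Pi.zero_apply]
      rw [hdx.lineDeriv_eq_fderiv, map_neg, hwfd]
      ring
    · refine (hI2 i).neg.congr (.of_forall fun x => ?_)
      have hdx := (hwC i).differentiable one_ne_zero x
      simp only [Pi.neg_apply]
      rw [hdx.lineDeriv_eq_fderiv, map_neg, hwfd]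
      ring
  have hsum : ∀ᵐ x : Conf d, fderiv ℝ f x (W x) + f x * ∑ i, fderiv ℝ W x (e i) i =
      ∑ i, (lineDeriv ℝ f x (e i) * w i x + f x * fderiv ℝ W x (e i) i) := by
    -- By Rademacher, `f` is differentiable almost everywhere, where its derivative along `W x`
    -- splits into partial derivatives.
    filter_upwards [hf.ae_differentiableAt (μ := volume)] with x hx
    rw [Finset.sum_add_distrib, Finset.mul_sum]
    congr 1
    have hWx : W x = ∑ i, W x i • e i := by
      have := (EuclideanSpace.basisFun (Fin d) ℝ).sum_repr (W x)
      simpa [e] using this.symm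
    conv_lhs => rw [hWx, map_sum]
    refine Finset.sum_congr rfl fun i _ => ?_
    rw [hx.lineDeriv_eq_fderiv, map_smul, smul_eq_mul, mul_comm]
    by_cases hxs : x ∈ tsupport f
    · simp [hw, (hχ1 x hxs).self_of_nhds]
    · simp [fderiv_of_notMem_tsupport ℝ hxs]
  rw [integral_congr_ae hsum, integral_finsetSum]
  · exact Finset.sum_eq_zero fun i _ => hibp i
  · exact fun i _ => (hI1 i).add (hI2 i)

/-! ### The density and the continuity equation at fixed time. -/

section Density

variable {d : ℕ} {j : ℝ × Conf d → ℝ × Conf d}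

theorem IsCurrent.hasDerivAt_density (hj : IsCurrent j) (s : ℝ) (q : Conf d) :
    HasDerivAt (fun s => (j (s, q)).1) (fderiv ℝ j (s, q) (1, 0)).1 s := by
  have h1 := (hj.contDiff.differentiable one_ne_zero (s, q)).hasFDerivAt
  have h2 : HasDerivAt (fun s : ℝ => (s, q)) ((1 : ℝ), (0 : Conf d)) s :=
    (hasDerivAt_id s).prodMk (hasDerivAt_const s q)
  have h3 := h1.comp_hasDerivAt s h2
  exact (ContinuousLinearMap.fst ℝ ℝ (Conf d)).hasFDerivAt.comp_hasDerivAt s h3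

theorem IsCurrent.contDiff_current_slice (hj : IsCurrent j) (s : ℝ) :
    ContDiff ℝ 1 fun q => (j (s, q)).2 :=
  contDiff_snd.comp (hj.contDiff.comp (contDiff_prodMk_right s))

theorem IsCurrent.deriv_density_eq (hj : IsCurrent j) (s : ℝ) (q : Conf d) :
    (fderiv ℝ j (s, q) (1, 0)).1 =
      -∑ i, fderiv ℝ (fun q => (j (s, q)).2) q (EuclideanSpace.single i 1) i := by
  have h1 := (hj.contDiff.differentiable one_ne_zero (s, q)).hasFDerivAt
  have h2 : HasFDerivAt (fun q => (j (s, q)).2) _ q :=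
    (ContinuousLinearMap.snd ℝ ℝ (Conf d)).hasFDerivAt.comp q (h1.comp q (hasFDerivAt_prodMk_right s q))
  rw [h2.fderiv]
  have := hj.divergence_eq_zero (s, q)
  rw [divergence] at this
  rw [eq_neg_iff_add_eq_zero]
  exact this

theorem IsCurrent.continuous_density (hj : IsCurrent j) : Continuous fun p => (j p).1 :=
  continuous_fst.comp hj.contDiff.continuous

end Density

/-! ### Conservation of transported test functions. -/

section Transport

variable {d : ℕ} {j : ℝ × Conf d → ℝ × Conf d} {V : ℝ → Conf d → Conf d}
  {X : ℝ → ℝ → Conf d → Conf d} {K : ℝ≥0} {c : ℝ} {g : Conf d → ℝ} {C : ℝ≥0}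

theorem IsGlobalFlow.lipschitzWith (hX : IsGlobalFlow V X) (hK : ∀ t, LipschitzWith K (V t))
    (s t : ℝ) : LipschitzWith (Real.exp (K * |t - s|)).toNNReal (X s t) :=
  LipschitzWith.of_dist_le_mul fun x y => by
    rw [Real.coe_toNNReal _ (Real.exp_pos _).le]
    exact hX.dist_le hK s t x y

theorem IsGlobalFlow.support_subset (hX : IsGlobalFlow V X) (hc : ∀ t x, ‖V t x‖ ≤ c)
    {R : ℝ} (hg : Function.support g ⊆ closedBall 0 R) (s r : ℝ) :
    Function.support (fun q => g (X s r q)) ⊆ closedBall 0 (R + c * |r - s|) := by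
  intro q hq
  have h1 := mem_closedBall.1 (hg hq)
  have h2 := hX.dist_time_le hc s r s q
  rw [hX.self, dist_comm] at h2
  exact mem_closedBall.2 ((dist_triangle _ _ _).trans (by linarith))

/-- The derivative of the integral of a test function carried along by the flow. -/
theorem hasDerivAt_integral_transport (hj : IsCurrent j) (hV : Continuous (Function.uncurry V))
    (hK : ∀ t, LipschitzWith K (V t)) (hc : ∀ t x, ‖V t x‖ ≤ c) (hX : IsGlobalFlow V X)
    (hg : LipschitzWith C g) (hgs : HasCompactSupport g) (s : ℝ) :
    HasDerivAt (fun s => ∫ q, g (X s 0 q) * (j (s, q)).1)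
      (∫ q, (fderiv ℝ (fun q => g (X s 0 q)) q (-V s q) * (j (s, q)).1 +
        g (X s 0 q) * (fderiv ℝ j (s, q) (1, 0)).1)) s := by
  have hc0 : 0 ≤ c := (norm_nonneg _).trans (hc 0 0)
  obtain ⟨R, hR⟩ := hgs.isCompact.isBounded.subset_closedBall (0 : Conf d)
  have hR : Function.support g ⊆ closedBall 0 R := (subset_tsupport g).trans hR
  set B : Set (Conf d) := closedBall 0 (R + c * (|s| + 1)) with hB
  have habs : ∀ r ∈ ball s 1, |r| ≤ |s| + 1 := fun r hr => by
    have : |r - s| < 1 := hr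
    linarith [abs_sub_abs_le_abs_sub r s]
  have hsuppB : ∀ r ∈ ball s 1, ∀ q ∉ B, g (X r 0 q) = 0 := by
    intro r hr q hq
    by_contra h
    refine hq (closedBall_subset_closedBall ?_ (hX.support_subset hc hR r 0 h))
    rw [zero_sub, abs_neg]
    gcongr
    exact habs r hr
  obtain ⟨Mg, hMg⟩ := hgs.exists_bound_of_continuous hg.continuous
  have hMg0 : 0 ≤ Mg := (norm_nonneg _).trans (hMg 0)
  set S : Set (ℝ × Conf d) := closedBall s 1 ×ˢ B
  have hSc : IsCompact S := (isCompact_closedBall _ _).prod (isCompact_closedBall _ _)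
  obtain ⟨Mρ, hMρ⟩ := hSc.exists_bound_of_continuousOn hj.continuous_density.continuousOn
  have hcont' : Continuous fun p : ℝ × Conf d => (fderiv ℝ j p (1, 0)).1 :=
    continuous_fst.comp ((hj.contDiff.continuous_fderiv one_ne_zero).clm_apply continuous_const)
  obtain ⟨L, hL⟩ := hSc.exists_bound_of_continuousOn hcont'.continuousOn
  have hρL : ∀ r ∈ ball s 1, ∀ r' ∈ ball s 1, ∀ q ∈ B,
      |(j (r, q)).1 - (j (r', q)).1| ≤ L * |r - r'| := by
    intro r hr r' hr' q hq
    exact (convex_ball s 1).norm_image_sub_le_of_norm_hasDerivWithin_le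
      (fun x _ => (hj.hasDerivAt_density x q).hasDerivWithinAt)
      (fun x hx => hL (x, q) ⟨ball_subset_closedBall hx, hq⟩) hr' hr
  set A : ℝ := C * (Real.exp (K * (|s| + 1)) * c) with hA
  have hA0 : 0 ≤ A := by positivity
  have hfL : ∀ r ∈ ball s 1, ∀ r' ∈ ball s 1, ∀ q,
      |g (X r 0 q) - g (X r' 0 q)| ≤ A * |r - r'| := by
    intro r hr r' hr' q
    rw [← Real.dist_eq, dist_comm]
    refine (hg.dist_le_mul _ _).trans ?_
    rw [hA, mul_assoc, mul_assoc]
    gcongr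
    refine (hX.dist_initial_time_le hK hc r' r 0 q).trans ?_
    gcongr
    rw [zero_sub, abs_neg]
    exact habs r' hr'
  -- This is the product-rule Lipschitz constant in time: `A` and `Mg` belong to the transported
  -- `g`, `L` and `Mρ` to the density. A single ball `B` contains the supports for all times within
  -- `1` of `s`.
  set b : Conf d → ℝ := B.indicator fun _ => A * Mρ + Mg * L
  refine (hasDerivAt_integral_of_dominated_loc_of_lip (μ := volume) (bound := b)
    (F := fun s q => g (X s 0 q) * (j (s, q)).1) (ball_mem_nhds s one_pos) ?_ ?_ ?_ ?_ ?_ ?_).2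
  · exact .of_forall fun r => ((hg.continuous.comp (hX.continuous hK r 0)).mul
      (hj.continuous_density.comp (Continuous.prodMk_right r))).aestronglyMeasurable
  · refine ((hg.continuous.comp (hX.continuous hK s 0)).mul
      (hj.continuous_density.comp (Continuous.prodMk_right s))).integrable_of_hasCompactSupport ?_
    refine HasCompactSupport.mul_right
      (HasCompactSupport.of_support_subset_isCompact (isCompact_closedBall 0 _)
        (hX.support_subset hc hR s 0))
  · have h1 : Measurable fun q => fderiv ℝ (fun q => g (X s 0 q)) q (-V s q) :=
      isBoundedBilinearMap_apply.continuous.measurable.comp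
        ((measurable_fderiv ℝ _).prodMk
          ((hV.comp (Continuous.prodMk_right s)).neg.measurable))
    refine ((h1.mul (hj.continuous_density.comp (Continuous.prodMk_right s)).measurable).add
      (Measurable.mul ?_ ?_)).aestronglyMeasurable
    · exact (hg.continuous.comp (hX.continuous hK s 0)).measurable
    · exact (hcont'.comp (Continuous.prodMk_right s)).measurable
  · refine .of_forall fun q => LipschitzOnWith.of_dist_le_mul fun r hr r' hr' => ?_
    rw [Real.coe_nnabs, Real.dist_eq, Real.dist_eq]
    by_cases hq : q ∈ B
    · simp only [b, indicator_of_mem hq]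
      have e1 : g (X r 0 q) * (j (r, q)).1 - g (X r' 0 q) * (j (r', q)).1 =
        (g (X r 0 q) - g (X r' 0 q)) * (j (r, q)).1 +
          g (X r' 0 q) * ((j (r, q)).1 - (j (r', q)).1) := by ring
      rw [e1]
      refine (abs_add_le _ _).trans ?_
      rw [abs_mul, abs_mul]
      have h1 := hMρ (r, q) ⟨ball_subset_closedBall hr, hq⟩
      have h2 := hMg (X r' 0 q)
      have h3 := hfL r hr r' hr' q
      have h4 := hρL r hr r' hr' q hq
      rw [Real.norm_eq_abs] at h1 h2
      calc _ ≤ (A * |r - r'|) * Mρ + Mg * (L * |r - r'|) := by gcongr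
        _ = (A * Mρ + Mg * L) * |r - r'| := by ring
        _ ≤ _ := by gcongr; exact le_abs_self _
    · simp [hsuppB r hr q hq, hsuppB r' hr' q hq, b, indicator_of_notMem hq]
  · exact (integrableOn_const measure_closedBall_lt_top.ne).integrable_indicator
      measurableSet_closedBall
  · have hflow : LipschitzWith _ fun q => g (X s 0 q) := hg.comp (hX.lipschitzWith hK s 0)
    filter_upwards [hflow.ae_differentiableAt (μ := volume)] with q hq
    have h1 := hX.hasDerivAt_initial_time hV hc s q
    -- By the group law `X r 0 q = X s 0 (X r s q)`, so the time derivative is the spatial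
    -- derivative of `g ∘ X s 0` at `q` applied to the derivative of `r ↦ X r s q`, namely `-V s q`.
    have h2 : HasDerivAt (fun r => g (X r 0 q)) (fderiv ℝ (fun q => g (X s 0 q)) q (-V s q)) s := by
      have h3 := hq.hasFDerivAt
      rw [← hX.self s q] at h3
      have h4 := h3.comp_hasDerivAt s h1
      simp only [hX.self] at h4
      refine h4.congr_of_eventuallyEq (.of_forall fun r => ?_)
      simp [hX.comp hK]
    exact h2.mul (hj.hasDerivAt_density s q)

/-- A test function which the flow carries only through points where `V` is the velocity of the
current has a conserved integral. -/
theorem integral_transport_eq (hj : IsCurrent j) (hV : Continuous (Function.uncurry V))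
    (hK : ∀ t, LipschitzWith K (V t)) (hc : ∀ t x, ‖V t x‖ ≤ c) (hX : IsGlobalFlow V X)
    (hg : LipschitzWith C g) (hgs : HasCompactSupport g) (hg0 : ∀ q, 0 ≤ g q) (t : ℝ)
    (hgV : ∀ q, g q ≠ 0 → ∀ s ∈ uIcc 0 t,
      (j (s, X 0 s q)).1 • V s (X 0 s q) = (j (s, X 0 s q)).2) :
    ∫ q, g (X t 0 q) * (j (t, q)).1 = ∫ q, g q * (j (0, q)).1 := by
  obtain ⟨R, hR⟩ := hgs.isCompact.isBounded.subset_closedBall (0 : Conf d)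
  have hR : Function.support g ⊆ closedBall 0 R := (subset_tsupport g).trans hR
  have hder : ∀ s ∈ uIcc 0 t,
      HasDerivAt (fun s => ∫ q, g (X s 0 q) * (j (s, q)).1) 0 s := by
    intro s hs
    convert! hasDerivAt_integral_transport hj hV hK hc hX hg hgs s using 1
    have hflow : LipschitzWith _ fun q => g (X s 0 q) := hg.comp (hX.lipschitzWith hK s 0)
    have hfs : HasCompactSupport fun q => g (X s 0 q) :=
      HasCompactSupport.of_support_subset_isCompact (isCompact_closedBall 0 _)
        (hX.support_subset hc hR s 0)
    have key := integral_fderiv_apply_add_mul_div hflow hfs (hj.contDiff_current_slice s)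
    rw [eq_comm, ← neg_eq_zero, ← integral_neg]
    refine Eq.trans ?_ key
    refine integral_congr_ae (.of_forall fun q => ?_)
    simp only
    rw [hj.deriv_density_eq, map_neg]
    -- Where the transported function vanishes it has a minimum, since `g ≥ 0`, so its derivative
    -- vanishes too and the value of `V` there is irrelevant. Elsewhere `j⁰ V = J`.
    by_cases hq : g (X s 0 q) = 0
    · have hmin : fderiv ℝ (fun q => g (X s 0 q)) q = 0 :=
        IsLocalMin.fderiv_eq_zero (.of_forall fun y => by simpa only [hq] using hg0 _)
      simp [hmin, hq]
    · have := hgV _ hq s hs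
      rw [hX.comp_self hK] at this
      rw [← this, map_smul, smul_eq_mul]
      ring
  have h := (convex_uIcc 0 t).norm_image_sub_le_of_norm_hasDerivWithin_le (C := 0)
    (fun s hs => (hder s hs).hasDerivWithinAt) (fun s _ => by simp) left_mem_uIcc right_mem_uIcc
  rw [zero_mul] at h
  have h2 := sub_eq_zero.1 (norm_le_zero_iff.1 h)
  simpa only [hX.self] using h2

end Transport

/-! ### Truncated velocity fields and the mass carried by survivors. -/

section Truncation

variable {d : ℕ} {j : ℝ × Conf d → ℝ × Conf d} {c : ℝ}

theorem density_nonneg (hc : 0 < c) (hbound : ∀ p, ‖(j p).2‖ ≤ c * (j p).1) (p : ℝ × Conf d) :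
    0 ≤ (j p).1 :=
  nonneg_of_mul_nonneg_right ((norm_nonneg _).trans (hbound p)) hc

/-- At a zero of `j⁰` the bound forces `J = 0`, so the identity holds at nodes as well. -/
theorem density_smul_velocity (hbound : ∀ p, ‖(j p).2‖ ≤ c * (j p).1) (p : ℝ × Conf d) :
    (j p).1 • velocity j p = (j p).2 := by
  by_cases h : (j p).1 = 0
  · have := hbound p
    rw [h, mul_zero, norm_le_zero_iff] at this
    rw [h, this, zero_smul]
  · rw [velocity, smul_inv_smul₀ h]

theorem norm_velocity_le (hc : 0 < c) (hbound : ∀ p, ‖(j p).2‖ ≤ c * (j p).1)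
    (p : ℝ × Conf d) : ‖velocity j p‖ ≤ c := by
  have h0 := density_nonneg hc hbound p
  rcases h0.eq_or_lt with h | h
  · rw [velocity, ← h]
    simpa using hc.le
  · rw [velocity, norm_smul, norm_inv, Real.norm_of_nonneg h0, inv_mul_le_iff₀ h, mul_comm]
    exact hbound p

theorem ne_zero_iff_density_pos (hc : 0 < c) (hbound : ∀ p, ‖(j p).2‖ ≤ c * (j p).1)
    (p : ℝ × Conf d) : j p ≠ 0 ↔ 0 < (j p).1 := by
  refine ⟨fun h => (density_nonneg hc hbound p).lt_of_ne fun h0 => h ?_, fun h h0 => ?_⟩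
  · refine Prod.ext h0.symm ?_
    rw [← density_smul_velocity hbound p, ← h0, zero_smul]
    rfl
  · simp [h0] at h

theorem IsCurrent.contDiffOn_velocity (hj : IsCurrent j) :
    ContDiffOn ℝ 1 (velocity j) {p | 0 < (j p).1} :=
  ((contDiff_fst.comp hj.contDiff).contDiffOn.inv fun _ hp => ne_of_gt hp).smul
    (contDiff_snd.comp hj.contDiff).contDiffOn

/-- The bounded part of space-time where the density is larger than `1 / (n + 1)`. -/
def coreSet (j : ℝ × Conf d → ℝ × Conf d) (n : ℕ) : Set (ℝ × Conf d) :=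
  {p | 1 / ((n : ℝ) + 1) < (j p).1} ∩ ball 0 n

theorem IsCurrent.isOpen_coreSet (hj : IsCurrent j) (n : ℕ) : IsOpen (coreSet j n) :=
  (isOpen_lt continuous_const hj.continuous_density).inter isOpen_ball

theorem coreSet_mono : Monotone (coreSet j) := fun _ _ h _ hp =>
  ⟨(Nat.one_div_le_one_div h).trans_lt (mem_ofPred.1 hp.1), ball_subset_ball (by exact_mod_cast h) hp.2⟩

theorem density_pos_of_mem_coreSet {n : ℕ} {p : ℝ × Conf d} (hp : p ∈ coreSet j n) :
    0 < (j p).1 :=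
  Nat.one_div_pos_of_nat.trans hp.1

theorem mem_iUnion_coreSet {p : ℝ × Conf d} (hp : 0 < (j p).1) : ∃ n, p ∈ coreSet j n := by
  obtain ⟨n, hn⟩ := exists_nat_one_div_lt hp
  obtain ⟨m, hm⟩ := exists_nat_gt ‖p‖
  exact ⟨max n m, lt_of_le_of_lt (Nat.one_div_le_one_div (le_max_left n m)) hn,
    mem_ball_zero_iff.2 (hm.trans_le (by exact_mod_cast le_max_right n m))⟩

/-- `X` is the global flow of a bounded Lipschitz field `V` which agrees with the velocity of the
current on `coreSet j n`. -/
structure IsTruncatedFlow (j : ℝ × Conf d → ℝ × Conf d) (c : ℝ) (n : ℕ) (V : ℝ → Conf d → Conf d)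
    (K : ℝ≥0) (X : ℝ → ℝ → Conf d → Conf d) : Prop where
  continuous_field : Continuous (Function.uncurry V)
  lipschitz_field : ∀ t, LipschitzWith K (V t)
  bound_field : ∀ t x, ‖V t x‖ ≤ c
  isGlobalFlow : IsGlobalFlow V X
  field_eq : ∀ t x, (t, x) ∈ coreSet j n → V t x = velocity j (t, x)

theorem exists_isTruncatedFlow (hj : IsCurrent j) (hc : 0 < c)
    (hbound : ∀ p, ‖(j p).2‖ ≤ c * (j p).1) (n : ℕ) : ∃ V K X, IsTruncatedFlow j c n V K X := by
  set A : Set (ℝ × Conf d) := {p | 1 / ((n : ℝ) + 1) ≤ (j p).1} ∩ closedBall 0 n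
  have hA : IsCompact A := (isCompact_closedBall _ _).inter_left
    (isClosed_le continuous_const hj.continuous_density)
  have hU : IsOpen {p | 0 < (j p).1} := isOpen_lt continuous_const hj.continuous_density
  obtain ⟨χ, hχ, hχs, hχU, hχ1, hχ01⟩ := exists_contDiff_bump hA hU
    fun p hp => mem_ofPred.2 (Nat.one_div_pos_of_nat.trans_le (mem_ofPred.1 hp.1))
  set F : ℝ × Conf d → Conf d := fun p => χ p • velocity j p with hF
  have hFs : HasCompactSupport F := hχs.smul_right
  have hFC : ContDiff ℝ 1 F := by
    rw [contDiff_iff_contDiffAt]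
    intro p
    by_cases hp : p ∈ tsupport χ
    · exact hχ.contDiffAt.smul (hj.contDiffOn_velocity.contDiffAt (hU.mem_nhds (hχU hp)))
    · have : F =ᶠ[𝓝 p] fun _ => 0 := by
        filter_upwards [notMem_tsupport_iff_eventuallyEq.1 hp] with y hy
        simp [hF, hy]
      exact contDiffAt_const.congr_of_eventuallyEq this
  obtain ⟨K, hK⟩ := hFC.lipschitzWith_of_hasCompactSupport hFs one_ne_zero
  have hKt : ∀ t : ℝ, LipschitzWith K fun x => F (t, x) := fun t => by
    simpa using! hK.comp (LipschitzWith.prodMk_left t)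
  have hFc : ∀ (t : ℝ) x, ‖F (t, x)‖ ≤ c := fun t x => by
    rw [hF, norm_smul, Real.norm_of_nonneg (hχ01 _).1]
    exact (mul_le_of_le_one_left (norm_nonneg _) (hχ01 _).2).trans (norm_velocity_le hc hbound _)
  have hFcont : Continuous (Function.uncurry fun t x => F (t, x)) := hFC.continuous
  obtain ⟨X, hX⟩ := exists_isGlobalFlow hFcont hKt hFc
  refine ⟨fun t x => F (t, x), K, X, hFcont, hKt, hFc, hX, fun t x h => ?_⟩
  have : χ (t, x) = 1 :=
    (hχ1 (t, x) ⟨mem_ofPred.2 (mem_ofPred.1 h.1).le, ball_subset_closedBall h.2⟩).self_of_nhds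
  simp [hF, this]

/-- The points whose trajectory stays in `coreSet j n` between the times `0` and `t`. -/
def survivors (j : ℝ × Conf d → ℝ × Conf d) (n : ℕ) (X : ℝ → ℝ → Conf d → Conf d) (t : ℝ) :
    Set (Conf d) :=
  {q | ∀ u ∈ Icc (0 : ℝ) 1, (u * t, X 0 (u * t) q) ∈ coreSet j n}

variable {n : ℕ} {V : ℝ → Conf d → Conf d} {K : ℝ≥0} {X : ℝ → ℝ → Conf d → Conf d}

/-- The parametrization `s = u * t` treats both signs of `t` at once and keeps the compact parameter
set `[0, 1]` independent of `t`. -/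
theorem mem_survivors_iff {t : ℝ} {q : Conf d} :
    q ∈ survivors j n X t ↔ ∀ s ∈ uIcc 0 t, (s, X 0 s q) ∈ coreSet j n := by
  have : uIcc 0 t = (fun u : ℝ => u * t) '' Icc 0 1 := by
    rw [← segment_eq_uIcc, segment_eq_image]
    simp
  rw [this, forall_mem_image]
  rfl

theorem survivors_anti {s t : ℝ} (hs : s ∈ uIcc 0 t) :
    survivors j n X t ⊆ survivors j n X s := fun _ hq =>
  mem_survivors_iff.2 fun r hr =>
    mem_survivors_iff.1 hq r (uIcc_subset_uIcc left_mem_uIcc hs hr)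

/-- Staying in an open set over a compact parameter interval is an open condition. Openness jointly
in time and starting point supplies the measurability needed for Tonelli. -/
theorem IsTruncatedFlow.isOpen_survivors (hj : IsCurrent j) (h : IsTruncatedFlow j c n V K X) :
    IsOpen {p : ℝ × Conf d | p.2 ∈ survivors j n X p.1} := by
  rw [isOpen_iff_mem_nhds]
  intro p hp
  refine isCompact_Icc.eventually_forall_of_forall_eventually
    (P := fun (p : ℝ × Conf d) (u : ℝ) => (u * p.1, X 0 (u * p.1) p.2) ∈ coreSet j n)
    fun u hu => ?_
  have hcont : Continuous fun z : (ℝ × Conf d) × ℝ => (z.2 * z.1.1, X 0 (z.2 * z.1.1) z.1.2) := by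
    have := h.isGlobalFlow.continuous_uncurry h.lipschitz_field 0
    refine Continuous.prodMk (by fun_prop) (this.comp (f := fun z : (ℝ × Conf d) × ℝ =>
      (z.2 * z.1.1, z.1.2)) (by fun_prop))
  exact hcont.continuousAt.eventually ((hj.isOpen_coreSet n).mem_nhds (hp u hu))

theorem IsTruncatedFlow.isOpen_survivors_slice (hj : IsCurrent j)
    (h : IsTruncatedFlow j c n V K X) (t : ℝ) : IsOpen (survivors j n X t) :=
  (h.isOpen_survivors hj).preimage (Continuous.prodMk_right t)

theorem IsCurrent.integrable_density (hj : IsCurrent j) (t : ℝ) :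
    Integrable fun q => (j (t, q)).1 :=
  not_imp_comm.1 integral_undef (by rw [hj.integral_eq_one t]; exact one_ne_zero)

theorem IsCurrent.isProbabilityMeasure (hj : IsCurrent j)
    (h0 : ∀ p, 0 ≤ (j p).1) (t : ℝ) : IsProbabilityMeasure (currentMeasure j t) := by
  refine ⟨?_⟩
  rw [currentMeasure, withDensity_apply _ MeasurableSet.univ, Measure.restrict_univ,
    ← ofReal_integral_eq_lintegral_ofReal (hj.integrable_density t) (.of_forall fun q => h0 _),
    hj.integral_eq_one, ENNReal.ofReal_one]

theorem IsCurrent.measurable_density (hj : IsCurrent j) (t : ℝ) :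
    Measurable fun q => ENNReal.ofReal (j (t, q)).1 :=
  (hj.continuous_density.comp (Continuous.prodMk_right t)).measurable.ennreal_ofReal

theorem lintegral_ofReal_currentMeasure (hj : IsCurrent j) (t : ℝ) {g : Conf d → ℝ}
    (hg : Continuous g) (hgs : HasCompactSupport g) (hg0 : ∀ q, 0 ≤ g q)
    (h0 : ∀ p, 0 ≤ (j p).1) :
    ∫⁻ q, ENNReal.ofReal (g q) ∂(currentMeasure j t) =
      ENNReal.ofReal (∫ q, g q * (j (t, q)).1) := by
  have hcont : Continuous fun q => g q * (j (t, q)).1 :=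
    hg.mul (hj.continuous_density.comp (Continuous.prodMk_right t))
  rw [ofReal_integral_eq_lintegral_ofReal
      (hcont.integrable_of_hasCompactSupport hgs.mul_right)
      (.of_forall fun q => mul_nonneg (hg0 q) (h0 _)), currentMeasure,
    lintegral_withDensity_eq_lintegral_mul _ (hj.measurable_density t)
      hg.measurable.ennreal_ofReal]
  refine lintegral_congr fun q => ?_
  rw [Pi.mul_apply, mul_comm, ENNReal.ofReal_mul (hg0 q)]

/-- The surviving part of `μ_0` is carried by the flow into a part of `μ_t`. -/
theorem IsTruncatedFlow.map_restrict_survivors_le (hj : IsCurrent j) (hc : 0 < c)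
    (hbound : ∀ p, ‖(j p).2‖ ≤ c * (j p).1) (h : IsTruncatedFlow j c n V K X) (t : ℝ) :
    ((currentMeasure j 0).restrict (survivors j n X t)).map (X 0 t) ≤ currentMeasure j t := by
  have h0 := density_nonneg hc hbound
  have := hj.isProbabilityMeasure h0
  have hX := h.isGlobalFlow
  have hXc : Continuous (X 0 t) := hX.continuous h.lipschitz_field 0 t
  have hS := h.isOpen_survivors_slice hj t
  -- For open `U`, inner regularity reduces to a compact set of survivors mapped into `U`, on which
  -- a bump function is transported. Outer regularity then gives all sets.
  have hopen : ∀ U, IsOpen U →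
      ((currentMeasure j 0).restrict (survivors j n X t)).map (X 0 t) U ≤ currentMeasure j t U := by
    intro U hU
    rw [Measure.map_apply hXc.measurable hU.measurableSet,
      Measure.restrict_apply (hXc.measurable hU.measurableSet)]
    have hW := (hU.preimage hXc).inter hS
    rw [hW.measure_eq_iSup_isCompact]
    refine iSup_le fun A => iSup_le fun hAW => iSup_le fun hA => ?_
    obtain ⟨g, hgC, hgs, hgW, hg1, hg01⟩ := exists_contDiff_bump hA hW hAW
    obtain ⟨D, hD⟩ := hgC.lipschitzWith_of_hasCompactSupport hgs one_ne_zero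
    have htrans := integral_transport_eq hj h.continuous_field h.lipschitz_field h.bound_field hX hD
      hgs (fun q => (hg01 q).1) t fun q hq s hs => by
        rw [h.field_eq _ _ (mem_survivors_iff.1 (hgW (subset_tsupport g hq)).2 s hs),
          density_smul_velocity hbound]
    have hgs' : HasCompactSupport fun q => g (X t 0 q) := by
      obtain ⟨R, hR⟩ := hgs.isCompact.isBounded.subset_closedBall (0 : Conf d)
      exact HasCompactSupport.of_support_subset_isCompact (isCompact_closedBall 0 _)
        (hX.support_subset h.bound_field ((subset_tsupport g).trans hR) t 0)
    calc currentMeasure j 0 A = ∫⁻ q, A.indicator 1 q ∂(currentMeasure j 0) :=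
          (lintegral_indicator_one hA.measurableSet).symm
      _ ≤ ∫⁻ q, ENNReal.ofReal (g q) ∂(currentMeasure j 0) := by
          refine lintegral_mono fun q => indicator_apply_le' (fun hq => ?_) fun _ => zero_le
          simp [(hg1 q hq).self_of_nhds]
      _ = ∫⁻ q, ENNReal.ofReal (g (X t 0 q)) ∂(currentMeasure j t) := by
          rw [lintegral_ofReal_currentMeasure hj 0 hD.continuous hgs (fun q => (hg01 q).1) h0,
            lintegral_ofReal_currentMeasure hj t (g := fun q => g (X t 0 q))
              (hD.continuous.comp (hX.continuous h.lipschitz_field t 0)) hgs'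
              (fun q => (hg01 _).1) h0, htrans]
      _ ≤ ∫⁻ q, U.indicator 1 q ∂(currentMeasure j t) := by
          refine lintegral_mono fun q => le_indicator_apply (fun _ => ?_) fun hq => ?_
          · exact ENNReal.ofReal_le_one.2 (hg01 _).2
          · by_contra hne
            have hg0 : g (X t 0 q) ≠ 0 := fun h0 => hne (by simp [h0])
            refine hq ?_
            have := (hgW (subset_tsupport g hg0)).1
            rwa [mem_preimage, hX.comp_self h.lipschitz_field] at this
      _ = currentMeasure j t U := lintegral_indicator_one hU.measurableSet
  refine Measure.le_iff'.2 fun B => ?_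
  rw [B.measure_eq_iInf_isOpen (currentMeasure j t)]
  exact le_iInf fun U => le_iInf fun hBU => le_iInf fun hU =>
    (measure_mono hBU).trans (hopen U hU)

end Truncation

/-! ### The cost of approaching a node. -/

section Nodes

variable {d : ℕ} {j : ℝ × Conf d → ℝ × Conf d} {c : ℝ}
  {n : ℕ} {V : ℝ → Conf d → Conf d} {K : ℝ≥0} {X : ℝ → ℝ → Conf d → Conf d}

/-- The reciprocal of the density along the trajectory of a survivor, and `0` otherwise. -/
noncomputable def survivorInvDensity (j : ℝ × Conf d → ℝ × Conf d) (n : ℕ) (X : ℝ → ℝ → Conf d → Conf d)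
    (t : ℝ) : Conf d → ℝ≥0∞ :=
  (survivors j n X t).indicator fun q => ENNReal.ofReal ((j (t, X 0 t q)).1)⁻¹

theorem IsTruncatedFlow.measurable_survivorInvDensity (hj : IsCurrent j)
    (h : IsTruncatedFlow j c n V K X) :
    Measurable fun p : ℝ × Conf d => survivorInvDensity j n X p.1 p.2 := by
  have h1 : Continuous fun p : ℝ × Conf d => (j (p.1, X 0 p.1 p.2)).1 :=
    hj.continuous_density.comp
      (continuous_fst.prodMk (h.isGlobalFlow.continuous_uncurry h.lipschitz_field 0))
  exact h1.measurable.inv.ennreal_ofReal.indicator (h.isOpen_survivors hj).measurableSet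

/-- Pushing forward to time `t` replaces `μ_0` by at most `j⁰(t, x) dx`, whose density cancels the
reciprocal. Speed at most `c` confines the image to the larger ball, so the bound does not depend on
`n`. -/
theorem IsTruncatedFlow.setLIntegral_survivorInvDensity_le (hj : IsCurrent j) (hc : 0 < c)
    (hbound : ∀ p, ‖(j p).2‖ ≤ c * (j p).1) (h : IsTruncatedFlow j c n V K X) (R t : ℝ) :
    ∫⁻ q in closedBall 0 R, survivorInvDensity j n X t q ∂(currentMeasure j 0) ≤
      volume (closedBall (0 : Conf d) (R + c * |t|)) := by
  set B : Set (Conf d) := closedBall 0 (R + c * |t|)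
  set F : Conf d → ℝ≥0∞ := B.indicator fun x => ENNReal.ofReal ((j (t, x)).1)⁻¹ with hF
  have hFm : Measurable F :=
    (hj.continuous_density.comp (Continuous.prodMk_right t)).measurable.inv.ennreal_ofReal.indicator
      measurableSet_closedBall
  have hS := (h.isOpen_survivors_slice hj t).measurableSet
  have hXm : Measurable (X 0 t) := (h.isGlobalFlow.continuous h.lipschitz_field 0 t).measurable
  calc ∫⁻ q in closedBall 0 R, survivorInvDensity j n X t q ∂(currentMeasure j 0)
      ≤ ∫⁻ q, (survivors j n X t).indicator (fun q => F (X 0 t q)) q ∂(currentMeasure j 0) := by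
        rw [← lintegral_indicator measurableSet_closedBall]
        refine lintegral_mono fun q => indicator_apply_le' (fun hq => ?_) fun _ => zero_le
        refine indicator_apply_le' (fun hqs => ?_) fun _ => zero_le
        have hB : X 0 t q ∈ B := by
          have h1 := h.isGlobalFlow.dist_time_le h.bound_field 0 t 0 q
          rw [h.isGlobalFlow.self, sub_zero] at h1
          refine mem_closedBall.2 ((dist_triangle _ q _).trans ?_)
          linarith [mem_closedBall.1 hq]
        rw [indicator_of_mem hqs, hF, indicator_of_mem hB]
    _ = ∫⁻ x, F x ∂(((currentMeasure j 0).restrict (survivors j n X t)).map (X 0 t)) := by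
        rw [lintegral_indicator hS, lintegral_map hFm hXm]
    _ ≤ ∫⁻ x, F x ∂(currentMeasure j t) :=
        lintegral_mono' (h.map_restrict_survivors_le hj hc hbound t) le_rfl
    _ = ∫⁻ x, ENNReal.ofReal (j (t, x)).1 * F x := by
        rw [currentMeasure, lintegral_withDensity_eq_lintegral_mul _ (hj.measurable_density t) hFm]
        rfl
    _ ≤ ∫⁻ x, B.indicator 1 x := by
        refine lintegral_mono fun x => le_indicator_apply (fun hx => ?_) fun hx => ?_
        · rw [hF, indicator_of_mem hx, ← ENNReal.ofReal_mul (density_nonneg hc hbound _)]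
          exact ENNReal.ofReal_le_one.2 mul_inv_le_one
        · rw [hF, indicator_of_notMem hx, mul_zero]
    _ = volume B := lintegral_indicator_one measurableSet_closedBall

/-- A bound on the rate of change of the density along trajectories, uniform in the truncation. -/
theorem exists_bound_deriv_density (hj : IsCurrent j) (R T c : ℝ) :
    ∃ M : ℝ, 0 < M ∧ ∀ p ∈ closedBall (0 : ℝ × Conf d) R, ∀ v : Conf d, ‖v‖ ≤ c →
      |(fderiv ℝ j p (T, T • v)).1| ≤ M := by
  obtain ⟨L, hL⟩ := (isCompact_closedBall (0 : ℝ × Conf d) R).exists_bound_of_continuousOn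
    (hj.contDiff.continuous_fderiv one_ne_zero).continuousOn
  refine ⟨|L| * (|T| * max 1 c) + 1, by positivity, fun p hp v hv => ?_⟩
  have h1 : ‖((T, T • v) : ℝ × Conf d)‖ ≤ |T| * max 1 c := by
    rw [Prod.norm_def, max_le_iff, norm_smul, Real.norm_eq_abs]
    exact ⟨le_mul_of_one_le_right (abs_nonneg T) (le_max_left _ _), by
      gcongr; exact hv.trans (le_max_right _ _)⟩
  calc |(fderiv ℝ j p (T, T • v)).1| ≤ ‖fderiv ℝ j p (T, T • v)‖ := norm_fst_le (fderiv ℝ j p (T, T • v))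
    _ ≤ ‖fderiv ℝ j p‖ * ‖((T, T • v) : ℝ × Conf d)‖ := ContinuousLinearMap.le_opNorm _ _
    _ ≤ |L| * (|T| * max 1 c) := by
        gcongr
        exact (hL p hp).trans (le_abs_self L)
    _ ≤ _ := by linarith

theorem IsTruncatedFlow.hasDerivAt_density_along (hj : IsCurrent j)
    (h : IsTruncatedFlow j c n V K X) (T : ℝ) (q : Conf d) (u : ℝ) :
    HasDerivAt (fun u => (j (u * T, X 0 (u * T) q)).1)
      (fderiv ℝ j (u * T, X 0 (u * T) q) (T, T • V (u * T) (X 0 (u * T) q))).1 u := by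
  have h0 : HasDerivAt (fun u : ℝ => u * T) T u := by
    simpa using (hasDerivAt_id u).mul_const T
  have h1 := (h.isGlobalFlow.isIntegralCurve 0 q (u * T)).scomp u h0
  have h2 := (hj.contDiff.differentiable one_ne_zero (u * T, X 0 (u * T) q)).hasFDerivAt
  have h3 := h2.comp_hasDerivAt u (h0.prodMk h1)
  exact (ContinuousLinearMap.fst ℝ ℝ (Conf d)).hasFDerivAt.comp_hasDerivAt u h3

/-- If the density along a trajectory drops from above `ε` to `1 / (n + 1)`, then the integral of
its reciprocal is logarithmically large in `n`. -/
theorem IsTruncatedFlow.log_le_setLIntegral_survivorInvDensity (hj : IsCurrent j)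
    (h : IsTruncatedFlow j c n V K X) {R T M ε : ℝ} (hM : 0 < M) (hε : 0 < ε)
    (hderiv : ∀ p ∈ closedBall (0 : ℝ × Conf d) (R + c * |T| + |T|), ∀ v : Conf d, ‖v‖ ≤ c →
      |(fderiv ℝ j p (T, T • v)).1| ≤ M)
    (hn : R + c * |T| + |T| < n) {q : Conf d} (hq : q ∈ closedBall 0 R) (hqε : ε ≤ (j (0, q)).1)
    (hqs : q ∉ survivors j n X T) :
    ENNReal.ofReal (Real.log (ε * (n + 1)) / M) ≤
      ∫⁻ u in Icc (0 : ℝ) 1, survivorInvDensity j n X (u * T) q := by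
  have hc0 : 0 ≤ c := (norm_nonneg _).trans (h.bound_field 0 0)
  set δ : ℝ := 1 / ((n : ℝ) + 1) with hδ
  have hδ0 : 0 < δ := Nat.one_div_pos_of_nat
  rcases le_or_gt ε δ with hεδ | hεδ
  · rw [ENNReal.ofReal_of_nonpos]
    · exact zero_le
    · refine div_nonpos_of_nonpos_of_nonneg (Real.log_nonpos (by positivity) ?_) hM.le
      rwa [← le_div_iff₀ (by positivity)]
  set y : ℝ → ℝ := fun u => (j (u * T, X 0 (u * T) q)).1 with hy
  set y' : ℝ → ℝ := fun u =>
    (fderiv ℝ j (u * T, X 0 (u * T) q) (T, T • V (u * T) (X 0 (u * T) q))).1 with hy'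
  have hyy' : ∀ u, HasDerivAt y (y' u) u := h.hasDerivAt_density_along hj T q
  have hyc : Continuous y := continuous_iff_continuousAt.2 fun u => (hyy' u).continuousAt
  have hpath : Continuous fun u : ℝ => (u * T, X 0 (u * T) q) :=
    (continuous_mul_const T).prodMk
      ((h.isGlobalFlow.isIntegralCurve 0 q).continuous.comp (continuous_mul_const T))
  have hy'c : Continuous y' :=
    continuous_fst.comp (((hj.contDiff.continuous_fderiv one_ne_zero).comp hpath).clm_apply
      (continuous_const.prodMk ((h.continuous_field.comp hpath).const_smul T)))
  have hnorm : ∀ u ∈ Icc (0 : ℝ) 1,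
      (u * T, X 0 (u * T) q) ∈ closedBall (0 : ℝ × Conf d) (R + c * |T| + |T|) := by
    intro u hu
    have hR0 : 0 ≤ R := dist_nonneg.trans (mem_closedBall.1 hq)
    have huT : |u * T| ≤ |T| := by
      rw [abs_mul, abs_of_nonneg hu.1]
      exact mul_le_of_le_one_left (abs_nonneg T) hu.2
    have h1 := h.isGlobalFlow.dist_time_le h.bound_field 0 (u * T) 0 q
    rw [h.isGlobalFlow.self, sub_zero] at h1
    rw [mem_closedBall_zero_iff, Prod.norm_def, max_le_iff, Real.norm_eq_abs]
    have hcT : 0 ≤ c * |T| := by positivity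
    refine ⟨by simp only; linarith, ?_⟩
    have h2 := dist_triangle (X 0 (u * T) q) q 0
    have h3 : c * |u * T| ≤ c * |T| := by gcongr
    rw [← dist_zero_right]
    linarith [mem_closedBall.1 hq, abs_nonneg T]
  -- As `n` exceeds the reachable radius, the trajectory can leave the core set only through low
  -- density.
  have hball : ∀ u ∈ Icc (0 : ℝ) 1, (u * T, X 0 (u * T) q) ∈ ball (0 : ℝ × Conf d) n :=
    fun u hu => closedBall_subset_ball hn (hnorm u hu)
  set B : Set ℝ := Icc 0 1 ∩ {u | y u ≤ δ} with hB
  have hBc : IsCompact B := isCompact_Icc.inter_right (isClosed_le hyc continuous_const)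
  have hBne : B.Nonempty := by
    by_contra hne
    refine hqs fun u hu => ⟨?_, hball u hu⟩
    by_contra hlt
    exact hne ⟨u, hu, mem_ofPred.2 (not_lt.1 hlt)⟩
  -- The first time at which the density is at most `δ`; before it the point is a survivor.
  set σ := sInf B
  have hσB : σ ∈ B := hBc.sInf_mem hBne
  have hlt : ∀ u, 0 ≤ u → u < σ → δ < y u := fun u hu0 huσ => by
    by_contra hle
    exact notMem_of_lt_csInf huσ hBc.bddBelow
      ⟨⟨hu0, huσ.le.trans hσB.1.2⟩, mem_ofPred.2 (not_lt.1 hle)⟩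
  have hy0 : ε ≤ y 0 := by
    simpa only [hy, zero_mul, h.isGlobalFlow.self] using hqε
  have hσ0 : 0 < σ := hσB.1.1.lt_of_ne fun h0 => by
    have h2 : y σ ≤ δ := mem_ofPred.1 hσB.2
    rw [← h0] at h2
    linarith
  have hge : ∀ u ∈ Icc 0 σ, δ ≤ y u := by
    rw [← closure_Ico hσ0.ne]
    exact fun u hu => closure_minimal (fun u hu => mem_ofPred.2 (hlt u hu.1 hu.2).le)
      (isClosed_le continuous_const hyc) hu
  have hpos : ∀ u ∈ uIcc 0 σ, 0 < y u := fun u hu =>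
    hδ0.trans_le (hge u (by rwa [uIcc_of_le hσ0.le] at hu))
  have hinv : ContinuousOn (fun u => (y u)⁻¹) (uIcc 0 σ) :=
    hyc.continuousOn.inv₀ fun u hu => (hpos u hu).ne'
  have hint1 : IntervalIntegrable (fun u => y' u / y u) volume 0 σ :=
    (hy'c.continuousOn.div hyc.continuousOn fun u hu => (hpos u hu).ne').intervalIntegrable
  have hint2 : IntervalIntegrable (fun u => (y u)⁻¹) volume 0 σ := hinv.intervalIntegrable
  have hftc := intervalIntegral.integral_eq_sub_of_hasDerivAt
    (fun u hu => (hyy' u).log (hpos u hu).ne') hint1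
  have hkey : Real.log (ε * (n + 1)) / M ≤ ∫ u in (0)..σ, (y u)⁻¹ := by
    rw [div_le_iff₀' hM]
    have h1 : Real.log (ε * (n + 1)) ≤ Real.log (y 0) - Real.log (y σ) := by
      have e1 : ε * (n + 1) = ε / δ := by rw [hδ, div_div_eq_mul_div, div_one]
      rw [e1, Real.log_div hε.ne' hδ0.ne']
      have := Real.log_le_log hε hy0
      have := Real.log_le_log (hpos σ right_mem_uIcc) (mem_ofPred.1 hσB.2)
      linarith
    -- From `y' ≥ -M`: the total decrease of `log y` is at most `M` times the integral of `1 / y`.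
    have h2 : -(∫ u in (0)..σ, y' u / y u) ≤ ∫ u in (0)..σ, M * (y u)⁻¹ := by
      rw [← intervalIntegral.integral_neg]
      refine intervalIntegral.integral_mono_on hσ0.le hint1.neg (hint2.const_mul M) fun u hu => ?_
      have hu1 : u ∈ Icc (0 : ℝ) 1 := ⟨hu.1, hu.2.trans hσB.1.2⟩
      have hyu : 0 < y u := hδ0.trans_le (hge u hu)
      have := (abs_le.1 (hderiv _ (hnorm u hu1) _ (h.bound_field (u * T) (X 0 (u * T) q)))).1
      rw [div_eq_mul_inv, ← neg_mul]
      gcongr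
      linarith
    rw [intervalIntegral.integral_const_mul] at h2
    linarith
  calc ENNReal.ofReal (Real.log (ε * (n + 1)) / M)
      ≤ ENNReal.ofReal (∫ u in (0)..σ, (y u)⁻¹) := ENNReal.ofReal_le_ofReal hkey
    _ = ∫⁻ u in Ioo 0 σ, ENNReal.ofReal (y u)⁻¹ := by
        rw [intervalIntegral.integral_of_le hσ0.le, integral_Ioc_eq_integral_Ioo,
          ofReal_integral_eq_lintegral_ofReal]
        · exact ((intervalIntegrable_iff_integrableOn_Ioo_of_le hσ0.le).1 hint2)
        · filter_upwards [ae_restrict_mem measurableSet_Ioo] with u hu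
          exact inv_nonneg.2 (hδ0.trans_le (hge u (Ioo_subset_Icc_self hu))).le
    _ = ∫⁻ u in Ioo 0 σ, survivorInvDensity j n X (u * T) q := by
        refine setLIntegral_congr_fun measurableSet_Ioo fun u hu => ?_
        have hmem : q ∈ survivors j n X (u * T) := fun v hv => by
          rw [← mul_assoc]
          have hvu : v * u ≤ u := mul_le_of_le_one_left hu.1.le hv.2
          have hvu0 : 0 ≤ v * u := mul_nonneg hv.1 hu.1.le
          exact ⟨mem_ofPred.2 (hlt _ hvu0 (hvu.trans_lt hu.2)),
            hball _ ⟨hvu0, (hvu.trans hu.2.le).trans hσB.1.2⟩⟩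
        simp only [survivorInvDensity, indicator_of_mem hmem, hy]
    _ ≤ ∫⁻ u in Icc (0 : ℝ) 1, survivorInvDensity j n X (u * T) q :=
        lintegral_mono_set (Ioo_subset_Icc_self.trans (Icc_subset_Icc_right hσB.1.2))

end Nodes

/-! ### Almost every point survives up to a given time. -/

section AlmostEverywhere

variable {d : ℕ} {j : ℝ × Conf d → ℝ × Conf d} {c : ℝ}
  {V : ℕ → ℝ → Conf d → Conf d} {K : ℕ → ℝ≥0} {X : ℕ → ℝ → ℝ → Conf d → Conf d}

/-- Chebyshev's argument: on the exceptional set the time integral of the reciprocal density is at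
least `log(ε (n + 1)) / M`, while by Tonelli its `μ_0`-integral is at most the volume of a fixed
ball. Let `n → ∞`. -/
theorem measure_diff_iUnion_survivors (hj : IsCurrent j) (hc : 0 < c)
    (hbound : ∀ p, ‖(j p).2‖ ≤ c * (j p).1) (h : ∀ n, IsTruncatedFlow j c n (V n) (K n) (X n))
    (T R : ℝ) {ε : ℝ} (hε : 0 < ε) :
    currentMeasure j 0 ((closedBall 0 R ∩ {q | ε ≤ (j (0, q)).1}) \
      ⋃ n, survivors j n (X n) T) = 0 := by
  have := hj.isProbabilityMeasure (density_nonneg hc hbound)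
  set N := (closedBall 0 R ∩ {q : Conf d | ε ≤ (j (0, q)).1}) \ ⋃ n, survivors j n (X n) T with hN
  set B := closedBall (0 : Conf d) (R + c * |T|)
  obtain ⟨M, hM, hderiv⟩ := exists_bound_deriv_density hj (R + c * |T| + |T|) T c
  have hle : ∀ n : ℕ, R + c * |T| + |T| < n →
      ENNReal.ofReal (Real.log (ε * (n + 1)) / M) * currentMeasure j 0 N ≤ volume B := by
    intro n hn
    have hmeas : Measurable fun p : Conf d × ℝ => survivorInvDensity j n (X n) (p.2 * T) p.1 :=
      ((h n).measurable_survivorInvDensity hj).comp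
        ((measurable_snd.mul_const T).prodMk measurable_fst)
    calc _ = ∫⁻ q in N, ENNReal.ofReal (Real.log (ε * (n + 1)) / M) ∂(currentMeasure j 0) := by
          rw [setLIntegral_const]
      _ ≤ ∫⁻ q in N, (∫⁻ u in Icc (0 : ℝ) 1, survivorInvDensity j n (X n) (u * T) q)
            ∂(currentMeasure j 0) := by
          refine setLIntegral_mono hmeas.lintegral_prod_right' fun q hq => ?_
          exact (h n).log_le_setLIntegral_survivorInvDensity hj hM hε hderiv hn hq.1.1
            (mem_ofPred.1 hq.1.2) fun hqs => hq.2 (mem_iUnion_of_mem n hqs)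
      _ ≤ ∫⁻ q in closedBall 0 R, (∫⁻ u in Icc (0 : ℝ) 1, survivorInvDensity j n (X n) (u * T) q)
            ∂(currentMeasure j 0) := lintegral_mono_set fun q hq => hq.1.1
      _ = ∫⁻ u in Icc (0 : ℝ) 1, ∫⁻ q in closedBall 0 R, survivorInvDensity j n (X n) (u * T) q
            ∂(currentMeasure j 0) := lintegral_lintegral_swap hmeas.aemeasurable
      _ ≤ ∫⁻ u in Icc (0 : ℝ) 1, volume B := by
          refine setLIntegral_mono measurable_const fun u hu => ?_
          refine ((h n).setLIntegral_survivorInvDensity_le hj hc hbound R (u * T)).trans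
            (measure_mono (closedBall_subset_closedBall ?_))
          rw [abs_mul, abs_of_nonneg hu.1]
          gcongr
          exact mul_le_of_le_one_left (abs_nonneg T) hu.2
      _ = volume B := by simp
  by_contra hne
  have htop : Tendsto (fun n : ℕ =>
      ENNReal.ofReal (Real.log (ε * (n + 1)) / M) * currentMeasure j 0 N) atTop (𝓝 ⊤) := by
    rw [← ENNReal.top_mul hne]
    refine ENNReal.Tendsto.mul_const (ENNReal.tendsto_ofReal_atTop.comp ?_) (.inl ENNReal.top_ne_zero)
    refine (Real.tendsto_log_atTop.comp ?_).atTop_div_const hM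
    exact (tendsto_atTop_add_const_right _ _ tendsto_natCast_atTop_atTop).const_mul_atTop hε
  have hev : ∀ᶠ n : ℕ in atTop,
      ENNReal.ofReal (Real.log (ε * (n + 1)) / M) * currentMeasure j 0 N ≤ volume B := by
    filter_upwards [tendsto_natCast_atTop_atTop.eventually_gt_atTop (R + c * |T| + |T|)] with n hn
    exact hle n hn
  exact (le_of_tendsto htop hev).not_gt measure_closedBall_lt_top

theorem ae_mem_survivors (hj : IsCurrent j) (hc : 0 < c)
    (hbound : ∀ p, ‖(j p).2‖ ≤ c * (j p).1) (h : ∀ n, IsTruncatedFlow j c n (V n) (K n) (X n))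
    (T : ℝ) : ∀ᵐ q ∂(currentMeasure j 0), ∃ n, q ∈ survivors j n (X n) T := by
  have h1 : ∀ᵐ q ∂(currentMeasure j 0), ENNReal.ofReal (j (0, q)).1 ≠ 0 :=
    (ae_withDensity_iff (hj.measurable_density 0)).2 (.of_forall fun _ h => h)
  have h2 := ae_all_iff.2 fun k : ℕ => measure_eq_zero_iff_ae_notMem.1
    (measure_diff_iUnion_survivors hj hc hbound h T k (Nat.one_div_pos_of_nat (n := k)))
  filter_upwards [h1, h2] with q hq0 hq
  have hpos : 0 < (j (0, q)).1 := by simpa using hq0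
  obtain ⟨k, hk⟩ := exists_nat_one_div_lt hpos
  obtain ⟨m, hm⟩ := exists_nat_gt ‖q‖
  by_contra hne
  refine hq (max k m) ⟨⟨?_, ?_⟩, by simpa using hne⟩
  · rw [mem_closedBall_zero_iff]
    exact hm.le.trans (by exact_mod_cast le_max_right k m)
  · exact mem_ofPred.2 ((Nat.one_div_le_one_div (le_max_left k m)).trans hk.le)

end AlmostEverywhere

/-! ### Global solutions and equivariance. -/

section Solutions

variable {d : ℕ} {j : ℝ × Conf d → ℝ × Conf d} {c : ℝ}
  {V : ℕ → ℝ → Conf d → Conf d} {K : ℕ → ℝ≥0} {X : ℕ → ℝ → ℝ → Conf d → Conf d}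

theorem IsTruncatedFlow.hasDerivAt_of_mem_survivors {n : ℕ} {V : ℝ → Conf d → Conf d} {K : ℝ≥0}
    {X : ℝ → ℝ → Conf d → Conf d} (h : IsTruncatedFlow j c n V K X) {t : ℝ} {q : Conf d}
    (hq : q ∈ survivors j n X t) {s : ℝ} (hs : s ∈ uIcc 0 t) :
    j (s, X 0 s q) ≠ 0 ∧
      HasDerivAt (fun s => X 0 s q) (velocity j (s, X 0 s q)) s := by
  have hmem := mem_survivors_iff.1 hq s hs
  refine ⟨fun h0 => ?_, ?_⟩
  · have := density_pos_of_mem_coreSet hmem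
    simp [h0] at this
  · rw [← h.field_eq _ _ hmem]
    exact h.isGlobalFlow.isIntegralCurve 0 q s

/-- A solution on a compact time interval is a trajectory of all but finitely many truncations. -/
theorem eventually_mem_survivors (hc : 0 < c) (hbound : ∀ p, ‖(j p).2‖ ≤ c * (j p).1)
    (hj : IsCurrent j) (h : ∀ n, IsTruncatedFlow j c n (V n) (K n) (X n)) {t : ℝ} {γ : ℝ → Conf d}
    (hγ : ∀ s ∈ uIcc 0 t, j (s, γ s) ≠ 0 ∧ HasDerivAt γ (velocity j (s, γ s)) s) :
    ∀ᶠ n in atTop, γ 0 ∈ survivors j n (X n) t ∧ ∀ s ∈ uIcc 0 t, X n 0 s (γ 0) = γ s := by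
  have hγc : ContinuousOn γ (uIcc 0 t) := fun s hs => (hγ s hs).2.continuousAt.continuousWithinAt
  obtain ⟨N, hN⟩ := (isCompact_uIcc.image_of_continuousOn
    (continuousOn_id.prodMk hγc)).elim_directed_cover (coreSet j) (hj.isOpen_coreSet)
    (by
      rintro _ ⟨s, hs, rfl⟩
      exact mem_iUnion.2 (mem_iUnion_coreSet ((ne_zero_iff_density_pos hc hbound _).1 (hγ s hs).1)))
    coreSet_mono.directed_le
  filter_upwards [eventually_ge_atTop N] with n hn
  have hcore : ∀ s ∈ uIcc 0 t, (s, γ s) ∈ coreSet j n := fun s hs =>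
    coreSet_mono hn (hN ⟨s, hs, rfl⟩)
  have hγV : ∀ s ∈ uIcc 0 t, HasDerivAt γ (V n s (γ s)) s := fun s hs => by
    rw [(h n).field_eq _ _ (hcore s hs)]
    exact (hγ s hs).2
  have hX := (h n).isGlobalFlow.isIntegralCurve 0 (γ 0)
  have hlip : ∀ s, LipschitzOnWith (K n) (V n s) univ := fun s =>
    ((h n).lipschitz_field s).lipschitzOnWith
  have heq : ∀ s ∈ uIcc 0 t, X n 0 s (γ 0) = γ s := by
    rcases le_total 0 t with ht | ht
    · rw [uIcc_of_le ht] at hγV hγc ⊢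
      exact ODE_solution_unique_of_mem_Icc_right (fun s _ => hlip s) hX.continuous.continuousOn
        (fun s _ => (hX s).hasDerivWithinAt) (fun _ _ => mem_univ _) hγc
        (fun s hs => (hγV s (Ico_subset_Icc_self hs)).hasDerivWithinAt) (fun _ _ => mem_univ _)
        ((h n).isGlobalFlow.self _ _)
    · rw [uIcc_of_ge ht] at hγV hγc ⊢
      exact ODE_solution_unique_of_mem_Icc_left (fun s _ => hlip s) hX.continuous.continuousOn
        (fun s _ => (hX s).hasDerivWithinAt) (fun _ _ => mem_univ _) hγc
        (fun s hs => (hγV s (Ioc_subset_Icc_self hs)).hasDerivWithinAt) (fun _ _ => mem_univ _)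
        ((h n).isGlobalFlow.self _ _)
  exact ⟨mem_survivors_iff.2 fun s hs => by rw [heq s hs]; exact hcore s hs, heq⟩

theorem eventually_of_mem_survivors (hc : 0 < c) (hbound : ∀ p, ‖(j p).2‖ ≤ c * (j p).1)
    (hj : IsCurrent j) (h : ∀ n, IsTruncatedFlow j c n (V n) (K n) (X n)) {t : ℝ} {q : Conf d}
    {m : ℕ} (hq : q ∈ survivors j m (X m) t) :
    ∀ᶠ n in atTop, q ∈ survivors j n (X n) t ∧ ∀ s ∈ uIcc 0 t, X n 0 s q = X m 0 s q := by
  have := eventually_mem_survivors hc hbound hj h (γ := fun s => X m 0 s q)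
    fun s hs => (h m).hasDerivAt_of_mem_survivors hq hs
  simpa only [(h m).isGlobalFlow.self] using this

theorem exists_isSolutionOn_univ (hc : 0 < c) (hbound : ∀ p, ‖(j p).2‖ ≤ c * (j p).1)
    (hj : IsCurrent j) (h : ∀ n, IsTruncatedFlow j c n (V n) (K n) (X n)) {q : Conf d}
    (hq : ∀ T : ℝ, ∃ n, q ∈ survivors j n (X n) T) : ∃ Q, IsSolutionOn j q univ Q := by
  -- The truncation level depends on the time; the values fit together because all sufficiently
  -- large levels agree on a compact time interval.
  choose N hN using hq
  set Q : ℝ → Conf d := fun s => X (N s) 0 s q with hQ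
  have key : ∀ t : ℝ, ∃ n, q ∈ survivors j n (X n) t ∧
      Q =ᶠ[𝓝 t] fun s => X n 0 s q := by
    intro t
    set T := |t| + 1
    obtain ⟨n, hn1, hn2⟩ := ((eventually_of_mem_survivors hc hbound hj h (hN T)).and
      (eventually_of_mem_survivors hc hbound hj h (hN (-T)))).exists
    have hs : ∀ s ∈ Icc (-T) T, q ∈ survivors j n (X n) s := by
      intro s hs
      rcases le_total 0 s with h0 | h0
      · exact survivors_anti (by rw [uIcc_of_le (h0.trans hs.2)]; exact ⟨h0, hs.2⟩) hn1.1
      · exact survivors_anti (by rw [uIcc_of_ge (hs.1.trans h0)]; exact ⟨hs.1, h0⟩) hn2.1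
    have hnhds : Icc (-T) T ∈ 𝓝 t :=
      Icc_mem_nhds (by linarith [neg_abs_le t]) (by linarith [le_abs_self t])
    refine ⟨n, hs t (mem_of_mem_nhds hnhds), ?_⟩
    filter_upwards [hnhds] with s hsT
    obtain ⟨m, hm1, hm2⟩ := ((eventually_of_mem_survivors hc hbound hj h (hN s)).and
      (eventually_of_mem_survivors hc hbound hj h (hs s hsT))).exists
    rw [hQ, ← hm2.2 s right_mem_uIcc]
    exact (hm1.2 s right_mem_uIcc).symm
  refine ⟨Q, isOpen_univ, ordConnected_univ, mem_univ _, ?_, fun t _ => ?_, fun t _ => ?_⟩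
  · exact (h _).isGlobalFlow.self 0 q
  · obtain ⟨n, hn, hev⟩ := key t
    rw [hev.self_of_nhds]
    exact ((h n).hasDerivAt_of_mem_survivors hn right_mem_uIcc).1
  · obtain ⟨n, hn, hev⟩ := key t
    rw [hev.self_of_nhds]
    exact ((h n).hasDerivAt_of_mem_survivors hn right_mem_uIcc).2.congr_of_eventuallyEq hev

theorem IsSolutionOn.eventually_eq (hc : 0 < c) (hbound : ∀ p, ‖(j p).2‖ ≤ c * (j p).1)
    (hj : IsCurrent j) (h : ∀ n, IsTruncatedFlow j c n (V n) (K n) (X n)) {q : Conf d}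
    {I : Set ℝ} {Q : ℝ → Conf d} (hQ : IsSolutionOn j q I Q) {t : ℝ} (ht : t ∈ I) :
    ∀ᶠ n in atTop, q ∈ survivors j n (X n) t ∧ X n 0 t q = Q t := by
  have hsub : uIcc 0 t ⊆ I := hQ.ordConnected.uIcc_subset hQ.zero_mem ht
  have := eventually_mem_survivors hc hbound hj h (γ := Q) (t := t)
    fun s hs => ⟨hQ.not_node s (hsub hs), hQ.hasDerivAt s (hsub hs)⟩
  rw [hQ.initial] at this
  exact this.mono fun n hn => ⟨hn.1, hn.2 t right_mem_uIcc⟩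

/-- Any two solutions from `q` agree at a common time, since each coincides there with the flow of
every large enough truncation. -/
theorem IsSolutionOn.isMaximalSolution (hc : 0 < c) (hbound : ∀ p, ‖(j p).2‖ ≤ c * (j p).1)
    (hj : IsCurrent j) {q : Conf d} {Q : ℝ → Conf d} (hQ : IsSolutionOn j q univ Q) :
    IsMaximalSolution j q univ Q := by
  choose V K X h using exists_isTruncatedFlow hj hc hbound
  refine ⟨hQ, fun I' Q' hQ' => ⟨subset_univ _, fun t ht => ?_⟩⟩
  obtain ⟨n, h1, h2⟩ := ((hQ'.eventually_eq hc hbound hj h ht).and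
    (hQ.eventually_eq hc hbound hj h (mem_univ t))).exists
  exact h1.2.symm.trans h2.2

theorem IsMaximalSolution.flow_eq {q : Conf d} {Q : ℝ → Conf d}
    (hQ : IsMaximalSolution j q univ Q) (t : ℝ) : flow j t q = Sum.inl (Q t) := by
  have hex : ∃ x : Conf d, ∃ (I : Set ℝ) (Q : ℝ → Conf d),
      IsMaximalSolution j q I Q ∧ t ∈ I ∧ Q t = x := ⟨Q t, univ, Q, hQ, mem_univ t, rfl⟩
  rw [flow, dif_pos hex]
  obtain ⟨I, Q', hQ', ht, hx⟩ := hex.choose_spec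
  rw [← hx, (hQ.maximal I Q' hQ'.isSolutionOn).2 ht]

theorem ae_exists_isMaximalSolution_univ (hj : IsCurrent j) (hc : 0 < c)
    (hbound : ∀ p, ‖(j p).2‖ ≤ c * (j p).1) :
    ∀ᵐ q ∂(currentMeasure j 0), ∃ Q : ℝ → Conf d, IsMaximalSolution j q univ Q := by
  choose V K X h using exists_isTruncatedFlow hj hc hbound
  -- Countably many times suffice: survival up to an integer time implies survival up to all times
  -- between it and `0`.
  have hae := ae_all_iff.2 fun k : ℤ => ae_mem_survivors hj hc hbound h (k : ℝ)
  filter_upwards [hae] with q hq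
  obtain ⟨Q, hQ⟩ := exists_isSolutionOn_univ hc hbound hj h (q := q) fun T => by
    rcases le_total 0 T with hT | hT
    · obtain ⟨n, hn⟩ := hq ⌈T⌉
      exact ⟨n, survivors_anti (mem_uIcc.2 (.inl ⟨hT, Int.le_ceil T⟩)) hn⟩
    · obtain ⟨n, hn⟩ := hq ⌊T⌋
      exact ⟨n, survivors_anti (mem_uIcc.2 (.inr ⟨Int.floor_le T, hT⟩)) hn⟩
  exact ⟨Q, hQ.isMaximalSolution hc hbound hj⟩

theorem isEquivariantOn_univ (hj : IsCurrent j) (hc : 0 < c)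
    (hbound : ∀ p, ‖(j p).2‖ ≤ c * (j p).1) : IsEquivariantOn j univ := by
  intro t _
  have hprob := hj.isProbabilityMeasure (density_nonneg hc hbound)
  choose V K X h using exists_isTruncatedFlow hj hc hbound
  -- The value `0` at the cemetery is arbitrary, as it is used only on a null set. Almost everywhere
  -- `φ` is the limit of the truncated flows, which makes it a.e. measurable.
  set φ : Conf d → Conf d := fun q => Sum.elim id (fun _ => 0) (flow j t q) with hφ
  have hae : ∀ᵐ q ∂(currentMeasure j 0), flow j t q = Sum.inl (φ q) ∧
      ∀ᶠ n in atTop, q ∈ survivors j n (X n) t ∧ X n 0 t q = φ q := by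
    filter_upwards [ae_exists_isMaximalSolution_univ hj hc hbound] with q ⟨Q, hQ⟩
    have hφq : φ q = Q t := by simp only [hφ, hQ.flow_eq t, Sum.elim_inl, id]
    rw [hφq]
    exact ⟨hQ.flow_eq t, hQ.isSolutionOn.eventually_eq hc hbound hj h (mem_univ t)⟩
  have hXm : ∀ n, Measurable (X n 0 t) := fun n =>
    ((h n).isGlobalFlow.continuous (h n).lipschitz_field 0 t).measurable
  have hφm : AEMeasurable φ (currentMeasure j 0) := by
    refine aemeasurable_of_tendsto_metrizable_ae atTop (fun n => (hXm n).aemeasurable) ?_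
    filter_upwards [hae] with q hq
    exact tendsto_const_nhds.congr' (hq.2.mono fun n hn => hn.2.symm)
  have hle : (currentMeasure j 0).map φ ≤ currentMeasure j t := by
    refine Measure.le_iff.2 fun B hB => ?_
    rw [Measure.map_apply_of_aemeasurable hφm hB]
    -- The increasing sets whose union is the lower limit of the sets of survivors carried into `B`;
    -- each lies in the `n`-th of these, where the domination by `μ_t` applies.
    set A : ℕ → Set (Conf d) := fun n => ⋂ m ≥ n, X m 0 t ⁻¹' B ∩ survivors j m (X m) t
    have hA : Monotone A := fun a b hab => biInter_mono (fun m hm => hab.trans hm) fun _ _ => le_rfl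
    calc currentMeasure j 0 (φ ⁻¹' B) ≤ currentMeasure j 0 (⋃ n, A n) := by
          refine measure_mono_ae ?_
          filter_upwards [hae] with q hq hqB
          obtain ⟨n, hn⟩ := eventually_atTop.1 hq.2
          refine mem_iUnion.2 ⟨n, mem_iInter₂.2 fun m hm => ⟨?_, (hn m hm).1⟩⟩
          rw [mem_preimage, (hn m hm).2]
          exact hqB
      _ = ⨆ n, currentMeasure j 0 (A n) := hA.measure_iUnion
      _ ≤ currentMeasure j t B := iSup_le fun n => by
          refine (measure_mono (biInter_subset_of_mem (mem_Ici.2 le_rfl))).trans ?_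
          rw [← Measure.restrict_apply (hXm n hB), ← Measure.map_apply (hXm n) hB]
          exact (h n).map_restrict_survivors_le hj hc hbound t B
  have := Measure.isProbabilityMeasure_map hφm
  rw [flowMeasure, Measure.map_congr (hae.mono fun q hq => hq.1),
    ← Measure.eq_of_le_of_isProbabilityMeasure hle]
  exact (AEMeasurable.map_map_of_aemeasurable measurable_inl.aemeasurable hφm).symm

end Solutions

end CurrentFlow


theorem mainTheorem3 (d : ℕ) (j : ℝ × CurrentFlow.Conf d → ℝ × CurrentFlow.Conf d)
    (hj : CurrentFlow.IsCurrent j) (c : ℝ) (hc : 0 < c)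
    (hbound : ∀ p : ℝ × CurrentFlow.Conf d, ‖(j p).2‖ ≤ c * (j p).1) :
    (∀ᵐ q ∂(CurrentFlow.currentMeasure j 0),
      ∃ Q : ℝ → CurrentFlow.Conf d, CurrentFlow.IsMaximalSolution j q Set.univ Q) ∧
    CurrentFlow.IsEquivariantOn j Set.univ :=
  ⟨CurrentFlow.ae_exists_isMaximalSolution_univ hj hc hbound,
    CurrentFlow.isEquivariantOn_univ hj hc hbound⟩
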